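/- **Finite-sampling bound.** Let $P$ be a probability measure on a measurable space $\mathcal{Z}$, let $n\ge 2$, and let $Z_1,\ldots,Z_n$ be independent random variables with distribution $P$. Let $M>0$, let $\ell\colon\mathcal{Z}\to[0,M]$ be a measurable loss function, and put $$\hat L_n:=\frac1n\sum_{i=1}^n\ell(Z_i),\qquad S_n^2:=\frac{1}{n(n-1)}\sum_{1\le i<j\le n}\bigl(\ell(Z_i)-\ell(Z_j)\bigr)^2 .$$ For probability measures $P,Q$ on $\mathcal Z$ let $H(P,Q)=\sqrt{\tfrac12\int\bigl(\sqrt{dP/d\nu}-\sqrt{dQ/d\nu}\bigr)^2d\nu}$ be the Hellinger distance, where $\nu$ is any $\sigma$-finite measure with $P,Q\ll\nu$ (for instance $\nu=P+Q$; the value does not depend on $\nu$). For $\rho>0$ let $B_\rho(P)$ be the set of probability measures $Q$ on $\mathcal{Z}$ with $H(P,Q)\le\rho$, and let $C_\rho=\sqrt{\rho^2(1-\rho^2)^2(2-\rho^2)}$. Then, for every $\rho>0$ and every $\delta\in(0,1)$, with probability at least $1-\delta$ the following holds: if $\rho$ is small enough that $$\rho^2\le 1-\left[1+\left(\frac{\hat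 L_n-M\left(1-\sqrt{\frac{\ln(2/\delta)}{2n}}\right)}{\sqrt{S_n^2}+M\sqrt{\frac{2\ln(2/\delta)}{n-1}}}\right)^2\right]^{-1/2},$$ then $$\sup_{Q\in B_\rho(P)}\mathbb{E}_{Q}[\ell(Z)]\le \hat L_n+2C_\rho\sqrt{S_n^2}+\Delta_{n,\rho}+\rho^2(2-\rho^2)\left[M-\hat L_n+\frac{S_n^2+2M\sqrt{\frac{2S_n^2\ln(2/\delta)}{n-1}}+\frac{2M^2\ln(2/\delta)}{n-1}}{\hat L_n-M\left(1-\sqrt{\frac{\ln(2/\delta)}{2n}}\right)}\right],$$ where $$\Delta_{n,\rho}=\left(\frac{2C_\rho}{\sqrt{n-1}}+\frac{1-\rho^2(2-\rho^2)}{2\sqrt n}\right)M\sqrt{2\ln(2/\delta)} .$$ -/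

import Mathlib

open MeasureTheory ProbabilityTheory

/-- The Hellinger distance between `P` and `Q` computed through a reference measure `μ`
(meant for `P, Q ≪ μ`):
`√(1/2 * ∫ (√(dP/dμ) - √(dQ/dμ))² dμ)`. -/
noncomputable def hellingerDistWrt {𝒵 : Type*} [MeasurableSpace 𝒵] (μ P Q : Measure 𝒵) : ℝ :=
  √((1 / 2) * ∫ z, (√((P.rnDeriv μ z).toReal) - √((Q.rnDeriv μ z).toReal)) ^ 2 ∂μ)

/-- The Hellinger distance `H(P, Q)`, computed through the reference measure `P + Q`. By
`hellingerDist_eq_hellingerDistWrt` every other admissible reference measure gives the same value.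
-/
noncomputable def hellingerDist {𝒵 : Type*} [MeasurableSpace 𝒵] (P Q : Measure 𝒵) : ℝ :=
  hellingerDistWrt (P + Q) P Q

/-- The Hellinger distance does not depend on the reference measure. -/
theorem hellingerDist_eq_hellingerDistWrt {𝒵 : Type*} [MeasurableSpace 𝒵] (μ P Q : Measure 𝒵)
    [SigmaFinite μ] [IsProbabilityMeasure P] [IsProbabilityMeasure Q] (hP : P ≪ μ) (hQ : Q ≪ μ) :
    hellingerDist P Q = hellingerDistWrt μ P Q := by
  have hPQ : P + Q ≪ μ := hP.add_left hQ
  have h1 : P ≪ P + Q := (Measure.le_add_right le_rfl).absolutelyContinuous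
  have h2 : Q ≪ P + Q := (Measure.le_add_left le_rfl).absolutelyContinuous
  unfold hellingerDist hellingerDistWrt
  congr 2
  rw [← integral_rnDeriv_smul hPQ]
  apply integral_congr_ae
  filter_upwards [Measure.rnDeriv_mul_rnDeriv (κ := μ) h1,
    Measure.rnDeriv_mul_rnDeriv (κ := μ) h2] with z hz1 hz2
  rw [← hz1, ← hz2]
  simp only [Pi.mul_apply, ENNReal.toReal_mul, smul_eq_mul]
  rw [Real.sqrt_mul ENNReal.toReal_nonneg, Real.sqrt_mul ENNReal.toReal_nonneg, ← sub_mul, mul_pow,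
    Real.sq_sqrt ENNReal.toReal_nonneg, mul_comm]

/-- The Hellinger ball `B_ρ(P) = {Q probability measure : H(P, Q) ≤ ρ}`. -/
def hellingerBall {𝒵 : Type*} [MeasurableSpace 𝒵] (P : Measure 𝒵) (ρ : ℝ) :
    Set (ProbabilityMeasure 𝒵) :=
  {Q | hellingerDist P (Q : Measure 𝒵) ≤ ρ}

/-- The worst-case risk `sup_{Q ∈ B_ρ(P)} E_Q[ℓ(Z)]`. -/
noncomputable def worstCaseRisk {𝒵 : Type*} [MeasurableSpace 𝒵] (P : Measure 𝒵) (ρ : ℝ)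
    (ℓ : 𝒵 → ℝ) : ℝ :=
  ⨆ Q : hellingerBall P ρ, ∫ z, ℓ z ∂((Q : ProbabilityMeasure 𝒵) : Measure 𝒵)

/-- The mean of the numbers `x₁, …, xₙ`. -/
noncomputable def sampleMean {n : ℕ} (x : Fin n → ℝ) : ℝ :=
  (1 / (n : ℝ)) * ∑ i, x i

/-- The unbiased sample variance `1 / (n (n - 1)) * ∑_{i < j} (xᵢ - xⱼ)²`. -/
noncomputable def sampleVariance {n : ℕ} (x : Fin n → ℝ) : ℝ :=
  (1 / ((n : ℝ) * ((n : ℝ) - 1))) * ∑ i, ∑ j ∈ Finset.Ioi i, (x i - x j) ^ 2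

/-- `C_ρ = √(ρ² (1 - ρ²)² (2 - ρ²))`. -/
noncomputable def hellingerC (ρ : ℝ) : ℝ :=
  √(ρ ^ 2 * (1 - ρ ^ 2) ^ 2 * (2 - ρ ^ 2))

/-- The sampling correction `Δ_{n,ρ}`. -/
noncomputable def samplingDelta (n : ℕ) (M ρ δ : ℝ) : ℝ :=
  (2 * hellingerC ρ / √((n : ℝ) - 1) + (1 - ρ ^ 2 * (2 - ρ ^ 2)) / (2 * √(n : ℝ)))
    * M * √(2 * Real.log (2 / δ))

/-- The finite-sampling bound as a function of the empirical mean `L` and the sample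
variance `S2`. -/
noncomputable def finiteSamplingBound (n : ℕ) (M ρ δ L S2 : ℝ) : ℝ :=
  L + 2 * hellingerC ρ * √S2 + samplingDelta n M ρ δ
    + ρ ^ 2 * (2 - ρ ^ 2) *
      (M - L +
        (S2 + 2 * M * √(2 * S2 * Real.log (2 / δ) / ((n : ℝ) - 1))
            + 2 * M ^ 2 * Real.log (2 / δ) / ((n : ℝ) - 1))
          / (L - M * (1 - √(Real.log (2 / δ) / (2 * (n : ℝ))))))

/-- The (data-dependent) requirement that the radius `ρ` be small enough. -/
def RadiusSmallEnough (n : ℕ) (M ρ δ L S2 : ℝ) : Prop :=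
  ρ ^ 2 ≤ 1 - (1 + ((L - M * (1 - √(Real.log (2 / δ) / (2 * (n : ℝ)))))
    / (√S2 + M * √(2 * Real.log (2 / δ) / ((n : ℝ) - 1)))) ^ 2) ^ (-(1 / 2) : ℝ)

/-!
The population statement behind the bound concerns `η = M - ℓ ≥ 0`, with mean `m` and standard
deviation `s` under `P`. Write `P = f² ν`, `Q = g² ν`; the constraint `H(P, Q) ≤ ρ` says
`⟪f, g⟫ ≥ c := 1 - ρ²` in `L²(ν)`. Splitting `g` along `f` and its orthogonal complement gives
`⟪η f, g⟫ ≥ c m - √(1 - c²) s`, and Cauchy–Schwarz gives `⟪η f, g⟫² ≤ m E_Q[η]`, so that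
`E_Q[ℓ] ≤ M - (c m - √(1 - c²) s)² / m` as long as the difference is nonnegative
(`le_integral_of_mem_hellingerBall`). This bound is monotone in `m` and `s`, so confidence limits
`M - U ≤ m` and `S ≥ s` may be substituted (`sq_div_le_integral_of_mem_hellingerBall`); the result
is exactly the claimed expression (`finiteSamplingBound_eq`), and the radius condition is exactly
nonnegativity of the substituted difference. If `U > M`, the claimed expression is at least `M` and
the bound is trivial; if `U = M`, the radius condition fails.

The confidence limits hold with probability at least `1 - δ / 2` each. For the mean this is
Hoeffding's inequality. For the standard deviation it is the Maurer–Pontil inequality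
`measureReal_sqrt_sampleVariance_add_lt_le`, obtained here by Hoeffding's averaging argument for
U-statistics rather than by the entropy method: the sample variance is an average, over
permutations of the sample, of means of `⌊n / 2⌋` independent terms, and a nonnegative bounded term
`Y` satisfies `E exp (-θ Y) ≤ exp (-θ E Y + θ² E Y² / 2)` for every `θ ≥ 0`. Since
`2 ⌊n / 2⌋ ≥ n - 1`, this yields the same constant.
-/

/-! ### Expected values over a Hellinger ball -/

theorem integral_linear_combination {α : Type*} [MeasurableSpace α] {ν : Measure α}
    {u v w : α → ℝ} (hu : Integrable u ν) (hv : Integrable v ν) (hw : Integrable w ν)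
    (a b c : ℝ) :
    ∫ z, (a * u z + b * v z + c * w z) ∂ν
      = a * (∫ z, u z ∂ν) + b * (∫ z, v z ∂ν) + c * ∫ z, w z ∂ν := by
  rw [integral_add ((hu.const_mul a).fun_add (hv.const_mul b)) (hw.const_mul c),
    integral_add (hu.const_mul a) (hv.const_mul b), integral_const_mul, integral_const_mul,
    integral_const_mul]

/-- The Cauchy–Schwarz inequality for real integrals, in squared form. -/
theorem sq_integral_mul_le {α : Type*} [MeasurableSpace α] {ν : Measure α} {u v : α → ℝ}
    (hu : MemLp u 2 ν) (hv : MemLp v 2 ν) :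
    (∫ z, u z * v z ∂ν) ^ 2 ≤ (∫ z, u z ^ 2 ∂ν) * ∫ z, v z ^ 2 ∂ν := by
  have huu := hu.integrable_sq
  have hvv := hv.integrable_sq
  have huv : Integrable (fun z => u z * v z) ν := hu.integrable_mul hv
  have key : ∀ x : ℝ, 0 ≤ (∫ z, u z ^ 2 ∂ν) * (x * x) + (2 * ∫ z, u z * v z ∂ν) * x
      + ∫ z, v z ^ 2 ∂ν := by
    intro x
    have h : ∫ z, (x * u z + v z) ^ 2 ∂ν = (∫ z, u z ^ 2 ∂ν) * (x * x)
        + (2 * ∫ z, u z * v z ∂ν) * x + ∫ z, v z ^ 2 ∂ν := by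
      have e : (fun z => (x * u z + v z) ^ 2) =
          fun z => (x * x) * u z ^ 2 + (2 * x) * (u z * v z) + 1 * v z ^ 2 := by
        funext z; ring
      rw [e, integral_linear_combination huu huv hvv]
      ring
    rw [← h]
    exact integral_nonneg fun z => sq_nonneg _
  have := discrim_le_zero key
  rw [discrim] at this
  linarith

/-- For unit vectors `f`, `g` of `L²(ν)` with `c ≤ ⟪f, g⟫`, and `η ≥ 0` bounded with mean `m` and
variance `v` under `f² ν`, the number `⟪η f, g⟫` is at least `c m - √(1 - c²) √v`: in the
decomposition `g = ⟪f, g⟫ f + h` with `h ⟂ f`, the second term only sees `(η - m) f`, and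
Cauchy–Schwarz applies. -/
theorem le_integral_mul_mul_of_le_affinity {α : Type*} [MeasurableSpace α] {ν : Measure α}
    [IsFiniteMeasure ν] {f g η : α → ℝ} {c K m v : ℝ}
    (hf : MemLp f 2 ν) (hg : MemLp g 2 ν) (hη : Measurable η) (hη0 : ∀ z, 0 ≤ η z)
    (hηK : ∀ z, η z ≤ K) (hff : ∫ z, f z ^ 2 ∂ν = 1) (hgg : ∫ z, g z ^ 2 ∂ν = 1)
    (hc : 0 ≤ c) (hfg : c ≤ ∫ z, f z * g z ∂ν) (hm : ∫ z, η z * f z ^ 2 ∂ν = m)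
    (hv : ∫ z, (η z - m) ^ 2 * f z ^ 2 ∂ν = v) :
    c * m - √(1 - c ^ 2) * √v ≤ ∫ z, η z * (f z * g z) ∂ν := by
  set a := ∫ z, f z * g z ∂ν with ha
  have hff' := hf.integrable_sq
  have hgg' := hg.integrable_sq
  have hfg' : Integrable (fun z => f z * g z) ν := hf.integrable_mul hg
  have hηm : MemLp (fun z => η z - m) ⊤ ν :=
    MemLp.of_bound (hη.sub_const m).aestronglyMeasurable (K + |m|) (.of_forall fun z => by
      have h1 := abs_sub (η z) m
      rw [abs_of_nonneg (hη0 z)] at h1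
      rw [Real.norm_eq_abs]
      linarith [hηK z])
  have hηL : MemLp η ⊤ ν :=
    MemLp.of_bound hη.aestronglyMeasurable K (.of_forall fun z => by
      rw [Real.norm_eq_abs, abs_of_nonneg (hη0 z)]; exact hηK z)
  have hu : MemLp (fun z => (η z - m) * f z) 2 ν := hf.mul hηm
  have hηf : MemLp (fun z => η z * f z) 2 ν := hf.mul hηL
  have hw : MemLp (fun z => g z - a * f z) 2 ν := hg.sub (hf.const_mul a)
  have hww : ∫ z, (g z - a * f z) ^ 2 ∂ν = 1 - a ^ 2 := by
    have e : (fun z => (g z - a * f z) ^ 2) =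
        fun z => 1 * g z ^ 2 + (-(2 * a)) * (f z * g z) + a ^ 2 * f z ^ 2 := by
      funext z; ring
    rw [e, integral_linear_combination hgg' hfg' hff', hff, hgg, ← ha]
    ring
  have huu : ∫ z, ((η z - m) * f z) ^ 2 ∂ν = v := by
    simp_rw [mul_pow]; exact hv
  have hηff : Integrable (fun z => η z * f z ^ 2) ν := by
    have := hηf.integrable_mul hf
    refine this.congr (.of_forall fun z => ?_)
    simp only [Pi.mul_apply]; ring
  have hηfg : Integrable (fun z => η z * (f z * g z)) ν := by
    have := hηf.integrable_mul hg
    refine this.congr (.of_forall fun z => ?_)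
    simp only [Pi.mul_apply]; ring
  have hsplit : ∫ z, (η z - m) * f z * (g z - a * f z) ∂ν
      = (∫ z, η z * (f z * g z) ∂ν) - m * a := by
    have e : (fun z => (η z - m) * f z * (g z - a * f z)) =
        fun z => 1 * (η z * (f z * g z)) + (-m) * (f z * g z)
          + (-a) * (η z * f z ^ 2 - m * f z ^ 2) := by
      funext z; ring
    rw [e, integral_linear_combination (w := fun z => η z * f z ^ 2 - m * f z ^ 2) hηfg hfg'
        (hηff.sub (hff'.const_mul m)),
      integral_sub hηff (hff'.const_mul m), integral_const_mul, hff, hm, ← ha]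
    ring
  have hcs := sq_integral_mul_le hu hw
  rw [huu, hww, hsplit] at hcs
  have hm0 : 0 ≤ m := hm ▸ integral_nonneg fun z => mul_nonneg (hη0 z) (sq_nonneg _)
  have hv0 : 0 ≤ v := huu ▸ integral_nonneg fun z => sq_nonneg _
  have habs := Real.abs_le_sqrt hcs
  rw [Real.sqrt_mul hv0] at habs
  have h1 : √(1 - a ^ 2) ≤ √(1 - c ^ 2) := by
    apply Real.sqrt_le_sqrt
    have := pow_le_pow_left₀ hc hfg 2
    linarith
  have h2 := mul_le_mul_of_nonneg_left h1 (Real.sqrt_nonneg v)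
  have h3 := mul_le_mul_of_nonneg_left hfg hm0
  linarith [(abs_le.mp habs).1]

/-- Under `H(P, Q) ≤ ρ`, the Hellinger affinity `∫ √(dP/dν) √(dQ/dν) dν` is at least `1 - ρ²`;
this turns the ball constraint into a lower bound on the mean of `η` under `Q`. The intermediate
quantity is `I = ∫ η √(dP/dν) √(dQ/dν) dν`. -/
theorem le_integral_of_mem_hellingerBall {𝒵 : Type*} [MeasurableSpace 𝒵] {P Q : Measure 𝒵}
    [IsProbabilityMeasure P] [IsProbabilityMeasure Q] {ρ : ℝ} (hρ : 0 ≤ ρ) (hρ1 : ρ ^ 2 ≤ 1)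
    (hPQ : hellingerDist P Q ≤ ρ) {η : 𝒵 → ℝ} (hη : Measurable η) {K : ℝ}
    (hη0 : ∀ z, 0 ≤ η z) (hηK : ∀ z, η z ≤ K) :
    ∃ I : ℝ, (1 - ρ ^ 2) * ∫ z, η z ∂P - √(1 - (1 - ρ ^ 2) ^ 2) * √Var[η; P] ≤ I ∧
      I ^ 2 ≤ (∫ z, η z ∂P) * ∫ z, η z ∂Q := by
  set ν := P + Q with hν
  have hP : P ≪ ν := (Measure.le_add_right le_rfl).absolutelyContinuous
  have hQ : Q ≪ ν := (Measure.le_add_left le_rfl).absolutelyContinuous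
  set f : 𝒵 → ℝ := fun z => √((P.rnDeriv ν z).toReal) with hf
  set g : 𝒵 → ℝ := fun z => √((Q.rnDeriv ν z).toReal) with hg
  have hfm : Measurable f := (Measure.measurable_rnDeriv P ν).ennreal_toReal.sqrt
  have hgm : Measurable g := (Measure.measurable_rnDeriv Q ν).ennreal_toReal.sqrt
  have hfsq : ∀ z, f z ^ 2 = (P.rnDeriv ν z).toReal := fun z => Real.sq_sqrt ENNReal.toReal_nonneg
  have hgsq : ∀ z, g z ^ 2 = (Q.rnDeriv ν z).toReal := fun z => Real.sq_sqrt ENNReal.toReal_nonneg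
  have hfL : MemLp f 2 ν := by
    rw [memLp_two_iff_integrable_sq hfm.aestronglyMeasurable]
    simp_rw [hfsq]; exact Measure.integrable_toReal_rnDeriv
  have hgL : MemLp g 2 ν := by
    rw [memLp_two_iff_integrable_sq hgm.aestronglyMeasurable]
    simp_rw [hgsq]; exact Measure.integrable_toReal_rnDeriv
  have hPint : ∀ φ : 𝒵 → ℝ, ∫ z, φ z * f z ^ 2 ∂ν = ∫ z, φ z ∂P := by
    intro φ
    simp_rw [hfsq, mul_comm (φ _)]
    exact integral_toReal_rnDeriv_mul hP
  have hQint : ∀ φ : 𝒵 → ℝ, ∫ z, φ z * g z ^ 2 ∂ν = ∫ z, φ z ∂Q := by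
    intro φ
    simp_rw [hgsq, mul_comm (φ _)]
    exact integral_toReal_rnDeriv_mul hQ
  have hff : ∫ z, f z ^ 2 ∂ν = 1 := by simpa using hPint fun _ => 1
  have hgg : ∫ z, g z ^ 2 ∂ν = 1 := by simpa using hQint fun _ => 1
  have hfg : 1 - ρ ^ 2 ≤ ∫ z, f z * g z ∂ν := by
    have h1 : (1 / 2) * ∫ z, (f z - g z) ^ 2 ∂ν ≤ ρ ^ 2 := (Real.sqrt_le_left hρ).mp hPQ
    have e : (fun z => (f z - g z) ^ 2) =
        fun z => 1 * f z ^ 2 + (-2) * (f z * g z) + 1 * g z ^ 2 := by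
      funext z; ring
    rw [e, integral_linear_combination (v := fun z => f z * g z) hfL.integrable_sq
      (hfL.integrable_mul hgL) hgL.integrable_sq, hff, hgg] at h1
    linarith
  have hvar : ∫ z, (η z - ∫ z, η z ∂P) ^ 2 * f z ^ 2 ∂ν = Var[η; P] := by
    rw [hPint, variance_eq_integral hη.aemeasurable]
  refine ⟨∫ z, η z * (f z * g z) ∂ν, le_integral_mul_mul_of_le_affinity hfL hgL hη hη0 hηK hff hgg
    (by linarith) hfg (hPint η) hvar, ?_⟩
  have hsL : MemLp (fun z => √(η z)) ⊤ ν :=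
    MemLp.of_bound hη.sqrt.aestronglyMeasurable (√K) (.of_forall fun z => by
      rw [Real.norm_eq_abs, abs_of_nonneg (Real.sqrt_nonneg _)]
      exact Real.sqrt_le_sqrt (hηK z))
  -- Cauchy–Schwarz for `√η f` and `√η g`
  have hcs := sq_integral_mul_le (u := fun z => √(η z) * f z) (v := fun z => √(η z) * g z)
    (hfL.mul hsL) (hgL.mul hsL)
  have e1 : ∀ z, √(η z) * f z * (√(η z) * g z) = η z * (f z * g z) := fun z => by
    linear_combination (f z * g z) * Real.sq_sqrt (hη0 z)
  simp_rw [e1, mul_pow, Real.sq_sqrt (hη0 _)] at hcs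
  rwa [hPint, hQint] at hcs

/-- The worst-case bound with estimates in place of the mean and the standard deviation:
`m₀` is a lower bound for the mean of `η`, `s₀` an upper bound for its standard deviation. -/
theorem sq_div_le_integral_of_mem_hellingerBall {𝒵 : Type*} [MeasurableSpace 𝒵] {P Q : Measure 𝒵}
    [IsProbabilityMeasure P] [IsProbabilityMeasure Q] {ρ : ℝ} (hρ : 0 ≤ ρ) (hρ1 : ρ ^ 2 ≤ 1)
    (hPQ : hellingerDist P Q ≤ ρ) {η : 𝒵 → ℝ} (hη : Measurable η) {K : ℝ}
    (hη0 : ∀ z, 0 ≤ η z) (hηK : ∀ z, η z ≤ K) {m₀ s₀ : ℝ} (hm₀ : 0 < m₀)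
    (hm : m₀ ≤ ∫ z, η z ∂P) (hs : √Var[η; P] ≤ s₀)
    (hsmall : √(1 - (1 - ρ ^ 2) ^ 2) * s₀ ≤ (1 - ρ ^ 2) * m₀) :
    ((1 - ρ ^ 2) * m₀ - √(1 - (1 - ρ ^ 2) ^ 2) * s₀) ^ 2 / m₀ ≤ ∫ z, η z ∂Q := by
  obtain ⟨I, hI1, hI2⟩ := le_integral_of_mem_hellingerBall hρ hρ1 hPQ hη hη0 hηK
  set m := ∫ z, η z ∂P
  set c := 1 - ρ ^ 2 with hc
  have hc0 : 0 ≤ c := by linarith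
  have hk : 0 ≤ √(1 - c ^ 2) * s₀ := mul_nonneg (Real.sqrt_nonneg _) ((Real.sqrt_nonneg _).trans hs)
  have hks := mul_le_mul_of_nonneg_left hs (Real.sqrt_nonneg (1 - c ^ 2))
  set k := √(1 - c ^ 2) * s₀
  have hcm := mul_le_mul_of_nonneg_left hm hc0
  have hm' : 0 < m := hm₀.trans_le hm
  have h1 : (c * m - k) ^ 2 ≤ m * ∫ z, η z ∂Q :=
    (pow_le_pow_left₀ (by linarith) (by linarith) 2).trans hI2
  have h2 : (c * m - k) ^ 2 / m ≤ ∫ z, η z ∂Q := by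
    rw [div_le_iff₀ hm']; linarith
  refine le_trans ?_ h2
  -- `t ↦ (c t - k)² / t` is nondecreasing where `c t ≥ k`
  have h3 : k * k ≤ (c * m₀) * (c * m) :=
    mul_le_mul hsmall (hsmall.trans hcm) hk (mul_nonneg hc0 hm₀.le)
  rw [div_le_div_iff₀ hm₀ hm']
  nlinarith [mul_nonneg (sub_nonneg.mpr hm) (sub_nonneg.mpr h3)]

/-! ### Concentration of the sample variance and the sample mean -/

open scoped Nat in
/-- Averaging one squared difference over all relabellings of the sample gives twice the sample
variance. -/
theorem sum_perm_sq_sub {n : ℕ} (hn : 2 ≤ n) (x : Fin n → ℝ) {a b : Fin n} (hab : a ≠ b) :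
    ∑ π : Equiv.Perm (Fin n), (x (π a) - x (π b)) ^ 2 = n ! * (2 * sampleVariance x) := by
  have hn' : (2 : ℝ) ≤ n := by exact_mod_cast hn
  set T : Fin n → Fin n → ℝ := fun i j => ∑ π : Equiv.Perm (Fin n), (x (π i) - x (π j)) ^ 2
    with hT
  have hTab : ∀ i j, i ≠ j → T i j = T a b := by
    intro i j hij
    obtain ⟨g, hga, hgb⟩ := (MulAction.is_two_pretransitive_iff (G := Equiv.Perm (Fin n))
      (α := Fin n)).mp (Equiv.Perm.isMultiplyPretransitive _ 2) hab hij
    rw [hT, ← hga, ← hgb]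
    exact Equiv.sum_comp (Equiv.mulRight g) fun π : Equiv.Perm (Fin n) => (x (π a) - x (π b)) ^ 2
  have h1 : ∑ i, ∑ j, T i j = (n : ℝ) * (n - 1) * T a b := by
    have : ∀ i j, T i j = T a b - if i = j then T a b else 0 := by
      intro i j
      split_ifs with h
      · simp [hT, h]
      · simp [hTab i j h]
    rw [Finset.sum_congr rfl fun i _ => Finset.sum_congr rfl fun j _ => this i j]
    simp [Finset.sum_sub_distrib]
    ring
  have h2 : ∑ i, ∑ j, T i j = n ! * ∑ i, ∑ j, (x i - x j) ^ 2 := by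
    have : ∀ π : Equiv.Perm (Fin n), ∑ i, ∑ j, (x (π i) - x (π j)) ^ 2
        = ∑ i, ∑ j, (x i - x j) ^ 2 := by
      intro π
      rw [← Equiv.sum_comp π fun i => ∑ j, (x i - x j) ^ 2]
      refine Finset.sum_congr rfl fun i _ => ?_
      exact Equiv.sum_comp π fun j => (x (π i) - x j) ^ 2
    calc ∑ i, ∑ j, T i j
        = ∑ π : Equiv.Perm (Fin n), ∑ i, ∑ j, (x (π i) - x (π j)) ^ 2 := by
          simp_rw [hT]
          rw [Finset.sum_comm (s := Finset.univ (α := Equiv.Perm (Fin n)))]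
          exact Finset.sum_congr rfl fun i _ => Finset.sum_comm
      _ = _ := by
          simp_rw [this]
          simp [Fintype.card_perm]
  have h3 : ∑ i, ∑ j, (x i - x j) ^ 2 = 2 * ∑ i, ∑ j ∈ Finset.Ioi i, (x i - x j) ^ 2 := by
    have h := Finset.sum_sum_Ioi_add_eq_sum_sum_off_diag fun i j => (x i - x j) ^ 2
    have e : ∀ i j, (x j - x i) ^ 2 = (x i - x j) ^ 2 := fun i j => by ring
    simp_rw [e, ← two_mul, ← Finset.mul_sum] at h
    rw [h]
    refine Finset.sum_congr rfl fun i _ => ?_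
    have := Finset.sum_add_sum_compl {i} fun j => (x i - x j) ^ 2
    rw [← this]
    simp
  have h4 := h1.symm.trans h2
  rw [h3] at h4
  have hpos : (0 : ℝ) < n * (n - 1) := mul_pos (by linarith) (by linarith)
  change T a b = _
  rw [sampleVariance]
  have hn1 : (n : ℝ) - 1 ≠ 0 := by linarith
  field_simp
  linarith

theorem Real.exp_neg_le_one_sub_add_sq_div_two {x : ℝ} (hx : 0 ≤ x) :
    Real.exp (-x) ≤ 1 - x + x ^ 2 / 2 := by
  have h := Real.quadratic_le_exp_of_nonneg hx
  have hpos : 0 < 1 + x + x ^ 2 / 2 := by positivity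
  rw [Real.exp_neg]
  calc (Real.exp x)⁻¹ ≤ (1 + x + x ^ 2 / 2)⁻¹ := inv_anti₀ hpos h
    _ ≤ 1 - x + x ^ 2 / 2 := by
      rw [inv_le_iff_one_le_mul₀ hpos]
      nlinarith [sq_nonneg (x ^ 2)]

theorem integrable_exp_neg {Ω : Type*} [MeasurableSpace Ω] {μ : Measure Ω} [IsFiniteMeasure μ]
    {Y : Ω → ℝ} (hY : AEMeasurable Y μ) (hY0 : ∀ ω, 0 ≤ Y ω) :
    Integrable (fun ω => Real.exp (-Y ω)) μ :=
  Integrable.of_mem_Icc 0 1 (Real.measurable_exp.comp_aemeasurable hY.neg)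
    (.of_forall fun ω => ⟨(Real.exp_pos _).le, Real.exp_le_one_iff.mpr (by linarith [hY0 ω])⟩)

/-- A one-sided Bernstein-type bound: the lower tail of a nonnegative variable needs no
restriction on `θ`. -/
theorem integral_exp_neg_le {Ω : Type*} [MeasurableSpace Ω] {μ : Measure Ω}
    [IsProbabilityMeasure μ] {Y : Ω → ℝ} (hY : AEMeasurable Y μ) {B θ : ℝ}
    (hY0 : ∀ ω, 0 ≤ Y ω) (hYB : ∀ ω, Y ω ≤ B) (hθ : 0 ≤ θ) :
    ∫ ω, Real.exp (-(θ * Y ω)) ∂μ ≤ Real.exp (-θ * μ[Y] + θ ^ 2 * B * μ[Y] / 2) := by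
  have hint : Integrable Y μ := Integrable.of_mem_Icc 0 B hY (.of_forall fun ω => ⟨hY0 ω, hYB ω⟩)
  calc ∫ ω, Real.exp (-(θ * Y ω)) ∂μ
      ≤ ∫ ω, (1 + (-θ + θ ^ 2 * B / 2) * Y ω) ∂μ := by
        refine integral_mono (integrable_exp_neg (hY.const_mul θ) fun ω => mul_nonneg hθ (hY0 ω))
          ((integrable_const _).add (hint.const_mul _)) fun ω => ?_
        refine (Real.exp_neg_le_one_sub_add_sq_div_two (mul_nonneg hθ (hY0 ω))).trans ?_
        have := mul_le_mul_of_nonneg_left (hYB ω) (mul_nonneg (sq_nonneg θ) (hY0 ω))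
        nlinarith
    _ = (-θ * μ[Y] + θ ^ 2 * B * μ[Y] / 2) + 1 := by
        rw [integral_add (integrable_const _) (hint.const_mul _), integral_const_mul]
        simp
        ring
    _ ≤ _ := Real.add_one_le_exp _

/-- Functions of disjoint pairs of independent variables factorize under the integral. -/
theorem ProbabilityTheory.iIndepFun.integral_prod_pairs {Ω ι κ : Type*} [MeasurableSpace Ω]
    {μ : Measure Ω} {X : ι → Ω → ℝ} (hX : iIndepFun X μ) (hXm : ∀ i, AEMeasurable (X i) μ)
    {F : ℝ → ℝ → ℝ} (hF : Measurable (Function.uncurry F)) (a b : κ → ι)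
    (hab : Function.Injective (Sum.elim a b)) (s : Finset κ) :
    ∫ ω, ∏ j ∈ s, F (X (a j) ω) (X (b j) ω) ∂μ
      = ∏ j ∈ s, ∫ ω, F (X (a j) ω) (X (b j) ω) ∂μ := by
  classical
  have := hX.isProbabilityMeasure
  have hFm : ∀ j, AEMeasurable (fun ω => F (X (a j) ω) (X (b j) ω)) μ := fun j =>
    hF.comp_aemeasurable ((hXm _).prodMk (hXm _))
  induction s using Finset.induction_on with
  | empty => simp
  | insert i s hi ih =>
    simp_rw [Finset.prod_insert hi]
    rw [← ih]
    have haa : ∀ p q, a p = a q → p = q := fun p q h => by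
      simpa using hab (a₁ := Sum.inl p) (a₂ := Sum.inl q) h
    have hbb : ∀ p q, b p = b q → p = q := fun p q h => by
      simpa using hab (a₁ := Sum.inr p) (a₂ := Sum.inr q) h
    have hne : ∀ p q, a p ≠ b q := fun p q h => by
      simpa using hab (a₁ := Sum.inl p) (a₂ := Sum.inr q) h
    have hdisj : Disjoint ({a i, b i} : Finset ι) (s.image a ∪ s.image b) := by
      rw [Finset.disjoint_left]
      intro c hc hc'
      simp only [Finset.mem_insert, Finset.mem_singleton, Finset.mem_union,
        Finset.mem_image] at hc hc'
      rcases hc with rfl | rfl <;> rcases hc' with ⟨j, hj, h⟩ | ⟨j, hj, h⟩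
      · exact hi (haa _ _ h ▸ hj)
      · exact hne _ _ h.symm
      · exact hne _ _ h
      · exact hi (hbb _ _ h ▸ hj)
    have hind := hX.indepFun_finset₀ _ _ hdisj hXm
    have ha : ∀ j : s, a j ∈ s.image a ∪ s.image b := fun j =>
      Finset.mem_union_left _ (Finset.mem_image_of_mem a j.2)
    have hb : ∀ j : s, b j ∈ s.image a ∪ s.image b := fun j =>
      Finset.mem_union_right _ (Finset.mem_image_of_mem b j.2)
    have hF2 : ∀ (T : Finset ι) (p q : T), Measurable fun y : T → ℝ => F (y p) (y q) :=
      fun T p q => by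
        have hpq : Measurable fun y : T → ℝ => (y p, y q) :=
          (measurable_pi_apply p).prodMk (measurable_pi_apply q)
        simpa only [Function.comp_def, Function.uncurry_apply_pair] using hF.comp hpq
    have hind' := hind.comp
      (φ := fun y => F (y ⟨a i, by simp⟩) (y ⟨b i, by simp⟩))
      (ψ := fun y : ↥(s.image a ∪ s.image b) → ℝ => ∏ j : s, F (y ⟨a j, ha j⟩) (y ⟨b j, hb j⟩))
      (hF2 _ _ _) (Finset.measurable_fun_prod _ fun j _ => hF2 _ _ _)
    have e : ∀ ω, ∏ j ∈ s, F (X (a j) ω) (X (b j) ω)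
        = ∏ j : s, F (X (a j) ω) (X (b j) ω) := fun ω =>
      (Finset.prod_coe_sort s fun j => F (X (a j) ω) (X (b j) ω)).symm
    simp_rw [e]
    exact hind'.integral_fun_mul_eq_mul_integral (hFm i).aestronglyMeasurable
      (Finset.aemeasurable_fun_prod (Finset.univ : Finset s) fun j _ => hFm j).aestronglyMeasurable

theorem ProbabilityTheory.IndepFun.integral_sq_sub {Ω : Type*} [MeasurableSpace Ω] {μ : Measure Ω}
    [IsProbabilityMeasure μ] {X Y : Ω → ℝ} (hX : MemLp X 2 μ) (hY : MemLp Y 2 μ)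
    (hXY : IndepFun X Y μ) (hE : μ[X] = μ[Y]) :
    ∫ ω, (X ω - Y ω) ^ 2 ∂μ = Var[X; μ] + Var[Y; μ] := by
  have h := variance_sub hX hY
  rw [hXY.covariance_eq_zero hX hY, variance_of_integral_eq_zero] at h
  · simp only [Pi.sub_apply] at h
    rw [h]; ring
  · exact (hX.aestronglyMeasurable.sub hY.aestronglyMeasurable).aemeasurable
  · simp only [Pi.sub_apply]
    rw [integral_sub (hX.integrable (by norm_num)) (hY.integrable (by norm_num)), hE, sub_self]

open scoped Nat in
/-- Laplace transform of the sample variance. By Hoeffding's averaging trick the sample variance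
is the mean, over all permutations, of an average of `n / 2` independent terms
`(Xᵢ - Xⱼ)² / 2`; Jensen's inequality reduces the bound to one permutation. -/
theorem integral_exp_neg_sampleVariance_le {Ω : Type*} [MeasurableSpace Ω] {μ : Measure Ω}
    [IsProbabilityMeasure μ] {n : ℕ} (hn : 2 ≤ n) {X : Fin n → Ω → ℝ} (hX : iIndepFun X μ)
    (hXm : ∀ i, AEMeasurable (X i) μ) {M e v : ℝ} (hXM : ∀ i ω, X i ω ∈ Set.Icc 0 M)
    (he : ∀ i, μ[X i] = e) (hv : ∀ i, Var[X i; μ] = v) {t : ℝ} (ht : 0 ≤ t) :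
    ∫ ω, Real.exp (-(t * sampleVariance fun i => X i ω)) ∂μ
      ≤ Real.exp (-t * v + t ^ 2 * M ^ 2 * v / (2 * (n - 1))) := by
  set k := n / 2 with hk
  have hk1 : 1 ≤ k := by omega
  have hk1' : (1 : ℝ) ≤ k := by exact_mod_cast hk1
  have hnk : (n : ℝ) - 1 ≤ 2 * k := by
    have : n ≤ 2 * k + 1 := by omega
    have : (n : ℝ) ≤ 2 * k + 1 := by exact_mod_cast this
    linarith
  have hn1 : (1 : ℝ) ≤ n - 1 := by
    have : (2 : ℝ) ≤ n := by exact_mod_cast hn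
    linarith
  have hv0 : 0 ≤ v := hv ⟨0, by omega⟩ ▸ variance_nonneg _ _
  let a : Fin k → Fin n := fun j => ⟨2 * j, by omega⟩
  let b : Fin k → Fin n := fun j => ⟨2 * j + 1, by omega⟩
  have hab : Function.Injective (Sum.elim a b) := by
    rintro (p | p) (q | q) h <;> simp only [Sum.elim_inl, Sum.elim_inr, a, b, Fin.mk.injEq] at h
    · exact congrArg _ (Fin.ext (by omega))
    · omega
    · omega
    · exact congrArg _ (Fin.ext (by omega))
  have hne : ∀ j, a j ≠ b j := fun j h => by
    simp only [a, b, Fin.mk.injEq] at h; omega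
  set θ : ℝ := t / (2 * k) with hθ
  have hθ0 : 0 ≤ θ := by positivity
  set W : Equiv.Perm (Fin n) → Ω → ℝ := fun π ω =>
    ∑ j, θ * (X (π (a j)) ω - X (π (b j)) ω) ^ 2 with hW
  have hW0 : ∀ π ω, 0 ≤ W π ω := fun π ω =>
    Finset.sum_nonneg fun j _ => mul_nonneg hθ0 (sq_nonneg _)
  have hWm : ∀ π, AEMeasurable (W π) μ := fun π =>
    Finset.aemeasurable_fun_sum _ fun j _ => (((hXm _).sub (hXm _)).pow_const 2).const_mul θ
  have hnf : (n ! : ℝ) ≠ 0 := by exact_mod_cast Nat.factorial_ne_zero n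
  have hSW : ∀ ω, t * (sampleVariance fun i => X i ω) = ∑ π, (n ! : ℝ)⁻¹ * W π ω := by
    intro ω
    have hk0 : (k : ℝ) ≠ 0 := by positivity
    simp_rw [hW, ← Finset.mul_sum]
    rw [Finset.sum_comm]
    simp_rw [fun j => sum_perm_sq_sub hn (fun i => X i ω) (hne j)]
    simp only [Finset.sum_const, Finset.card_univ, Fintype.card_fin, nsmul_eq_mul]
    rw [hθ]
    field_simp
  have hwsum : ∑ _π : Equiv.Perm (Fin n), (n ! : ℝ)⁻¹ = 1 := by
    simp [Fintype.card_perm, hnf]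
  have hone : ∀ π, ∫ ω, Real.exp (-W π ω) ∂μ
      ≤ Real.exp (-t * v + t ^ 2 * M ^ 2 * v / (2 * (n - 1))) := by
    intro π
    have hpair : ∀ j, ∫ ω, Real.exp (-(θ * (X (π (a j)) ω - X (π (b j)) ω) ^ 2)) ∂μ
        ≤ Real.exp (-θ * (v + v) + θ ^ 2 * M ^ 2 * (v + v) / 2) := by
      intro j
      have hL : ∀ i, MemLp (X i) 2 μ := fun i =>
        memLp_of_bounded (.of_forall (hXM i)) (hXm i).aestronglyMeasurable 2
      have hsq := IndepFun.integral_sq_sub (hL (π (a j))) (hL (π (b j)))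
        (hX.indepFun (π.injective.ne (hne j))) ((he _).trans (he _).symm)
      rw [hv, hv] at hsq
      rw [← hsq]
      refine integral_exp_neg_le (((hXm _).sub (hXm _)).pow_const 2) (fun ω => sq_nonneg _)
        (fun ω => ?_) hθ0
      obtain ⟨h1, h2⟩ := hXM (π (a j)) ω
      obtain ⟨h3, h4⟩ := hXM (π (b j)) ω
      exact sq_le_sq' (by rw [Pi.sub_apply]; linarith) (by rw [Pi.sub_apply]; linarith)
    have hprod := iIndepFun.integral_prod_pairs hX hXm
      (F := fun x y => Real.exp (-(θ * (x - y) ^ 2)))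
      (by unfold Function.uncurry; fun_prop) (π ∘ a) (π ∘ b)
      (by rw [← Sum.comp_elim]; exact π.injective.comp hab) Finset.univ
    simp_rw [← Real.exp_sum, Finset.sum_neg_distrib] at hprod
    refine hprod.trans_le ?_
    refine (Finset.prod_le_prod (fun j _ => integral_nonneg fun ω => (Real.exp_pos _).le)
      fun j _ => hpair j).trans ?_
    rw [Finset.prod_const, ← Real.exp_nat_mul, Finset.card_univ, Fintype.card_fin,
      Real.exp_le_exp]
    have hk0 : (k : ℝ) ≠ 0 := by positivity
    have e1 : (k : ℝ) * (-θ * (v + v) + θ ^ 2 * M ^ 2 * (v + v) / 2)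
        = -t * v + t ^ 2 * M ^ 2 * v / (2 * (2 * k)) := by
      rw [hθ]; field_simp; ring
    rw [e1]
    gcongr
  calc ∫ ω, Real.exp (-(t * sampleVariance fun i => X i ω)) ∂μ
      ≤ ∫ ω, ∑ π, (n ! : ℝ)⁻¹ * Real.exp (-W π ω) ∂μ := by
        have hint : ∀ π, Integrable (fun ω => (n ! : ℝ)⁻¹ * Real.exp (-W π ω)) μ := fun π =>
          (integrable_exp_neg (hWm π) (hW0 π)).const_mul _
        simp_rw [hSW]
        refine integral_mono (integrable_exp_neg
            (Finset.aemeasurable_fun_sum _ fun π _ => (hWm π).const_mul _)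
            fun ω => Finset.sum_nonneg fun π _ => mul_nonneg (by positivity) (hW0 π ω))
          (integrable_finsetSum _ fun π _ => hint π) fun ω => ?_
        have := convexOn_exp.map_sum_le (t := Finset.univ)
          (w := fun _ : Equiv.Perm (Fin n) => (n ! : ℝ)⁻¹) (p := fun π => -W π ω)
          (fun _ _ => by positivity) hwsum (fun _ _ => Set.mem_univ _)
        simpa only [smul_eq_mul, mul_neg, Finset.sum_neg_distrib] using this
    _ = ∑ π, (n ! : ℝ)⁻¹ * ∫ ω, Real.exp (-W π ω) ∂μ := by
        rw [integral_finsetSum _ fun π _ =>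
          (integrable_exp_neg (hWm π) (hW0 π)).const_mul _]
        simp_rw [integral_const_mul]
    _ ≤ ∑ π : Equiv.Perm (Fin n),
          (n ! : ℝ)⁻¹ * Real.exp (-t * v + t ^ 2 * M ^ 2 * v / (2 * (n - 1))) :=
        Finset.sum_le_sum fun π _ => mul_le_mul_of_nonneg_left (hone π) (by positivity)
    _ = _ := by rw [← Finset.sum_mul, hwsum, one_mul]

theorem sampleVariance_nonneg {n : ℕ} (hn : 2 ≤ n) (x : Fin n → ℝ) : 0 ≤ sampleVariance x := by
  have hn' : (2 : ℝ) ≤ n := by exact_mod_cast hn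
  have : (0 : ℝ) < n * (n - 1) := mul_pos (by linarith) (by linarith)
  exact mul_nonneg (by positivity)
    (Finset.sum_nonneg fun i _ => Finset.sum_nonneg fun j _ => sq_nonneg _)

/-- The Maurer–Pontil bound: the standard deviation exceeds the sample standard deviation by more
than `M √(2 l / (n - 1))` with probability at most `exp (-l)`. -/
theorem measureReal_sqrt_sampleVariance_add_lt_le {Ω : Type*} [MeasurableSpace Ω] {μ : Measure Ω}
    [IsProbabilityMeasure μ] {n : ℕ} (hn : 2 ≤ n) {X : Fin n → Ω → ℝ} (hX : iIndepFun X μ)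
    (hXm : ∀ i, AEMeasurable (X i) μ) {M e v : ℝ} (hM : 0 < M)
    (hXM : ∀ i ω, X i ω ∈ Set.Icc 0 M) (he : ∀ i, μ[X i] = e) (hv : ∀ i, Var[X i; μ] = v)
    {l : ℝ} (hl : 0 ≤ l) :
    μ.real {ω | √(sampleVariance fun i => X i ω) + M * √(2 * l / (n - 1)) < √v}
      ≤ Real.exp (-l) := by
  have hn1 : (1 : ℝ) ≤ n - 1 := by
    have : (2 : ℝ) ≤ n := by exact_mod_cast hn
    linarith
  set d := √(2 * l / (n - 1)) with hd
  have hd0 : 0 ≤ d := Real.sqrt_nonneg _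
  have hd2 : d ^ 2 = 2 * l / (n - 1) := Real.sq_sqrt (by positivity)
  by_cases hvd : √v ≤ M * d
  · have : {ω | √(sampleVariance fun i => X i ω) + M * d < √v} = ∅ := by
      ext ω
      simp only [Set.mem_ofPred_eq, Set.mem_empty_iff_false, iff_false, not_lt]
      linarith [Real.sqrt_nonneg (sampleVariance fun i => X i ω)]
    rw [this]
    simpa using (Real.exp_pos _).le
  push Not at hvd
  have hσ : 0 < √v := lt_of_le_of_lt (by positivity) hvd
  have hv0 : 0 < v := Real.sqrt_pos.mp hσ
  have hσ2 : √v ^ 2 = v := Real.sq_sqrt hv0.le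
  -- the minimizer of the Chernoff exponent
  set t : ℝ := d * (n - 1) / (M * √v) with ht
  have ht0 : 0 ≤ t := by positivity
  have hVm : AEMeasurable (fun ω => sampleVariance fun i => X i ω) μ := by
    unfold sampleVariance
    exact (Finset.aemeasurable_fun_sum _ fun i _ => Finset.aemeasurable_fun_sum _ fun j _ =>
      ((hXm i).sub (hXm j)).pow_const 2).const_mul _
  have hsub : {ω | √(sampleVariance fun i => X i ω) + M * d < √v}
      ⊆ {ω | (sampleVariance fun i => X i ω) ≤ v - M * d * √v} := by
    intro ω hω
    simp only [Set.mem_ofPred_eq] at hω ⊢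
    have h0 := sampleVariance_nonneg hn fun i => X i ω
    have h1 := Real.sqrt_nonneg (sampleVariance fun i => X i ω)
    have h2 := Real.sq_sqrt h0
    have hMd : 0 ≤ M * d := by positivity
    nlinarith
  refine (measureReal_mono hsub).trans ?_
  have hint : Integrable (fun ω => Real.exp (-t * sampleVariance fun i => X i ω)) μ := by
    simpa only [neg_mul] using integrable_exp_neg (hVm.const_mul t)
      fun ω => mul_nonneg ht0 (sampleVariance_nonneg hn _)
  refine (measure_le_le_exp_mul_mgf (v - M * d * √v) (neg_nonpos.mpr ht0) hint).trans ?_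
  have hmgf := integral_exp_neg_sampleVariance_le hn hX hXm hXM he hv ht0
  simp_rw [← neg_mul] at hmgf
  refine (mul_le_mul_of_nonneg_left hmgf (Real.exp_pos _).le).trans ?_
  rw [← Real.exp_add, Real.exp_le_exp]
  apply le_of_eq
  have e1 : t * (M * √v) = d * (n - 1) := by
    rw [ht]; field_simp
  have e2 : d ^ 2 * (n - 1) = 2 * l := by
    rw [hd2]; field_simp
  have e3 : t ^ 2 * M ^ 2 * v / (2 * (n - 1)) = l := by
    have : t ^ 2 * M ^ 2 * v = d ^ 2 * (n - 1) * (n - 1) := by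
      rw [← hσ2]
      linear_combination (t * (M * √v) + d * (n - 1)) * e1
    rw [this, e2]
    field_simp
  rw [e3]
  linear_combination (-d) * e1 - e2

/-- Hoeffding's inequality for the sample mean, lower tail. -/
theorem measureReal_sampleMean_add_lt_le {Ω : Type*} [MeasurableSpace Ω] {μ : Measure Ω}
    [IsProbabilityMeasure μ] {n : ℕ} (hn : 0 < n) {X : Fin n → Ω → ℝ} (hX : iIndepFun X μ)
    (hXm : ∀ i, AEMeasurable (X i) μ) {M e : ℝ} (hM : 0 < M)
    (hXM : ∀ i ω, X i ω ∈ Set.Icc 0 M) (he : ∀ i, μ[X i] = e) {l : ℝ} (hl : 0 ≤ l) :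
    μ.real {ω | (sampleMean fun i => X i ω) + M * √(l / (2 * n)) < e} ≤ Real.exp (-l) := by
  have hn0 : (0 : ℝ) < n := by exact_mod_cast hn
  set ε := √(l / (2 * n)) with hε
  have hε2 : ε ^ 2 = l / (2 * n) := Real.sq_sqrt (by positivity)
  have hsub : ∀ i, HasSubgaussianMGF (fun ω => e - X i ω) ((‖M - 0‖₊ / 2) ^ 2) μ := by
    intro i
    have h := (hasSubgaussianMGF_of_mem_Icc (hXm i) (.of_forall (hXM i))).neg
    rw [he] at h
    refine h.congr (.of_forall fun ω => ?_)
    simp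
  have hind : iIndepFun (fun i ω => e - X i ω) μ :=
    hX.comp (fun _ x => e - x) fun _ => measurable_const.sub measurable_id
  have h := HasSubgaussianMGF.measure_sum_ge_le_of_iIndepFun hind (s := Finset.univ)
    (fun i _ => hsub i) (ε := n * (M * ε)) (by positivity)
  refine (measureReal_mono fun ω hω => ?_).trans (h.trans_eq ?_)
  · simp only [Set.mem_ofPred_eq, sampleMean] at hω ⊢
    simp only [Finset.sum_sub_distrib, Finset.sum_const, Finset.card_univ, Fintype.card_fin,
      nsmul_eq_mul]
    have := mul_lt_mul_of_pos_left hω hn0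
    rw [mul_add, ← mul_assoc, mul_one_div_cancel hn0.ne', one_mul] at this
    linarith
  · congr 1
    have e1 : ((‖M - 0‖₊ / 2 : NNReal) : ℝ) = M / 2 := by simp [abs_of_pos hM]
    simp only [Finset.sum_const, Finset.card_univ, Fintype.card_fin, nsmul_eq_mul,
      NNReal.coe_mul, NNReal.coe_natCast, NNReal.coe_pow, e1]
    have e2 : (n * (M * ε)) ^ 2 = n * M ^ 2 * l / 2 := by
      rw [mul_pow, mul_pow, hε2]; field_simp
    rw [e2]
    field_simp

/-! ### The bound as a function of the estimates -/

/-- The finite-sampling bound is the population bound with the mean replaced by its upper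
confidence limit and the standard deviation by its upper confidence limit. -/
theorem finiteSamplingBound_eq {n : ℕ} (hn : 2 ≤ n) {M ρ δ L S2 : ℝ}
    (hρ1 : ρ ^ 2 ≤ 1) (hS2 : 0 ≤ S2) (hl : 0 ≤ Real.log (2 / δ)) {U s : ℝ}
    (hU : U = L + M * √(Real.log (2 / δ) / (2 * n)))
    (hs : s = √S2 + M * √(2 * Real.log (2 / δ) / (n - 1))) :
    finiteSamplingBound n M ρ δ L S2
      = M - (1 - ρ ^ 2) ^ 2 * (M - U) + 2 * ((1 - ρ ^ 2) * √(1 - (1 - ρ ^ 2) ^ 2)) * s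
        + (1 - (1 - ρ ^ 2) ^ 2) * (s ^ 2 / (U - M)) := by
  set l := Real.log (2 / δ)
  have hn2 : (2 : ℝ) ≤ n := by exact_mod_cast hn
  have hn1 : (0 : ℝ) < n - 1 := by linarith
  have hn0 : (0 : ℝ) < n := by linarith
  set ε := √(l / (2 * n)) with hε
  set d := √(2 * l / (n - 1)) with hd
  have hd2 : d ^ 2 = 2 * l / (n - 1) := Real.sq_sqrt (by positivity)
  have hC : hellingerC ρ = (1 - ρ ^ 2) * √(1 - (1 - ρ ^ 2) ^ 2) := by
    rw [hellingerC, ← Real.sqrt_sq (sub_nonneg.mpr hρ1), ← Real.sqrt_mul (sq_nonneg _),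
      Real.sqrt_sq (sub_nonneg.mpr hρ1)]
    congr 1; ring
  have h1 : √(2 * l) / √((n : ℝ) - 1) = d := by rw [hd, Real.sqrt_div (by positivity)]
  have h2 : √(2 * l) / (2 * √(n : ℝ)) = ε := by
    have h4 : √(4 : ℝ) = 2 := by
      rw [show (4 : ℝ) = 2 ^ 2 by norm_num]; exact Real.sqrt_sq (by norm_num)
    rw [hε, ← h4, ← Real.sqrt_mul (by norm_num), ← Real.sqrt_div (by positivity)]
    congr 1
    field_simp
    ring
  have h3 : √(2 * S2 * l / (n - 1)) = √S2 * d := by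
    rw [hd, ← Real.sqrt_mul hS2]; congr 1; ring
  have h4 : S2 + 2 * M * √(2 * S2 * l / (n - 1)) + 2 * M ^ 2 * l / (n - 1) = s ^ 2 := by
    have e : 2 * M ^ 2 * l / (n - 1) = M ^ 2 * d ^ 2 := by rw [hd2]; ring
    rw [h3, hs, e]
    linear_combination -Real.sq_sqrt hS2
  have h5 : L - M * (1 - ε) = U - M := by rw [hU]; ring
  have h6 : samplingDelta n M ρ δ
      = 2 * hellingerC ρ * (M * d) + (1 - ρ ^ 2 * (2 - ρ ^ 2)) * (M * ε) := by
    rw [samplingDelta, ← h1, ← h2]; ring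
  rw [finiteSamplingBound, h4, h5, h6, hC, hU, hs]
  ring

theorem one_sub_sq_le_of_le_one_sub_rpow {c r : ℝ}
    (h : (1 + r ^ 2) ^ (-(1 / 2) : ℝ) ≤ c) : 0 < c ∧ 1 - c ^ 2 ≤ c ^ 2 * r ^ 2 := by
  have hpos : 0 < 1 + r ^ 2 := by positivity
  have hp := Real.rpow_pos_of_pos hpos (-(1 / 2) : ℝ)
  refine ⟨hp.trans_le h, ?_⟩
  have h2 := pow_le_pow_left₀ hp.le h 2
  rw [← Real.rpow_natCast, ← Real.rpow_mul hpos.le] at h2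
  norm_num at h2
  rw [Real.rpow_neg_one, inv_le_iff_one_le_mul₀ hpos] at h2
  linarith

/-- Deterministic core: whenever the mean and the standard deviation of the loss lie below their
upper confidence limits, the bound holds. -/
theorem worstCaseRisk_le_finiteSamplingBound {𝒵 : Type*} [MeasurableSpace 𝒵] {P : Measure 𝒵}
    [IsProbabilityMeasure P] {n : ℕ} (hn : 2 ≤ n) {M : ℝ} (hM : 0 < M) {ℓ : 𝒵 → ℝ}
    (hℓ : Measurable ℓ) (hrange : ∀ z, ℓ z ∈ Set.Icc 0 M) {ρ : ℝ} (hρ : 0 < ρ)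
    {δ L S2 : ℝ} (hl : 0 < Real.log (2 / δ)) (hS2 : 0 ≤ S2)
    (hmean : ∫ z, ℓ z ∂P ≤ L + M * √(Real.log (2 / δ) / (2 * n)))
    (hsd : √Var[ℓ; P] ≤ √S2 + M * √(2 * Real.log (2 / δ) / (n - 1)))
    (hsmall : RadiusSmallEnough n M ρ δ L S2) :
    worstCaseRisk P ρ ℓ ≤ finiteSamplingBound n M ρ δ L S2 := by
  have hn1 : (0 : ℝ) < n - 1 := by
    have : (2 : ℝ) ≤ n := by exact_mod_cast hn
    linarith
  have hρ2 : 0 < ρ ^ 2 := by positivity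
  set U := L + M * √(Real.log (2 / δ) / (2 * n)) with hU
  set s := √S2 + M * √(2 * Real.log (2 / δ) / (n - 1)) with hs
  have hs0 : 0 < s := by positivity
  have hrad : (1 + ((U - M) / s) ^ 2) ^ (-(1 / 2) : ℝ) ≤ 1 - ρ ^ 2 := by
    have h : L - M * (1 - √(Real.log (2 / δ) / (2 * (n : ℝ)))) = U - M := by rw [hU]; ring
    rw [RadiusSmallEnough, h, ← hs] at hsmall
    linarith
  obtain ⟨hc0, hc⟩ := one_sub_sq_le_of_le_one_sub_rpow hrad
  have hB := finiteSamplingBound_eq (δ := δ) (L := L) hn (by linarith : ρ ^ 2 ≤ 1) hS2 hl.le hU hs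
  rw [hB]
  set c := 1 - ρ ^ 2 with hcdef
  have hc1 : c < 1 := by linarith
  have ha : 0 < 1 - c ^ 2 := by nlinarith
  have hball : hellingerDist P P ≤ ρ := by
    simp [hellingerDist, hellingerDistWrt, hρ.le]
  have : Nonempty (hellingerBall P ρ) := ⟨⟨⟨P, inferInstance⟩, hball⟩⟩
  refine ciSup_le fun ⟨Q, hQ⟩ => ?_
  have hint : ∀ Q' : Measure 𝒵, IsProbabilityMeasure Q' → Integrable ℓ Q' := fun Q' _ =>
    Integrable.of_mem_Icc 0 M hℓ.aemeasurable (.of_forall hrange)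
  have hη : ∀ Q' : Measure 𝒵, IsProbabilityMeasure Q' →
      ∫ z, (M - ℓ z) ∂Q' = M - ∫ z, ℓ z ∂Q' := fun Q' hQ' => by
    rw [integral_sub (integrable_const M) (hint Q' hQ')]; simp
  have hsq := Real.sq_sqrt ha.le
  rcases lt_trichotomy U M with hUM | hUM | hUM
  · have hm0 : 0 < M - U := by linarith
    have hk : √(1 - c ^ 2) * s ≤ c * (M - U) := by
      refine le_of_sq_le_sq ?_ (by positivity)
      rw [mul_pow, hsq, mul_pow]
      have := mul_le_mul_of_nonneg_right hc (sq_nonneg s)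
      rw [div_pow, mul_assoc, div_mul_cancel₀ _ (by positivity)] at this
      linarith
    have hvar : Var[fun z => M - ℓ z; P] = Var[ℓ; P] :=
      variance_const_sub hℓ.aestronglyMeasurable M
    have h := sq_div_le_integral_of_mem_hellingerBall hρ.le (by linarith) hQ
      (η := fun z => M - ℓ z) (measurable_const.sub hℓ) (K := M)
      (fun z => by linarith [(hrange z).2]) (fun z => by linarith [(hrange z).1]) hm0
      (by rw [hη P inferInstance]; linarith) (hvar ▸ hsd) hk
    rw [hη Q inferInstance, ← hcdef] at h
    have e : (c * (M - U) - √(1 - c ^ 2) * s) ^ 2 / (M - U)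
        = c ^ 2 * (M - U) - 2 * (c * √(1 - c ^ 2)) * s - (1 - c ^ 2) * (s ^ 2 / (U - M)) := by
      have h1 : U - M ≠ 0 := by linarith
      have h2 : M - U = -(U - M) := by ring
      rw [h2]
      field_simp
      linear_combination (-s ^ 2) * hsq
    linarith
  · -- here the radius condition forces `ρ = 0`
    rw [hUM, sub_self, zero_div] at hc
    linarith
  · -- the bound exceeds the trivial bound `M`
    have h1 : ∫ z, ℓ z ∂(Q : Measure 𝒵) ≤ M := by
      have := integral_mono (hint Q inferInstance) (integrable_const M) fun z => (hrange z).2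
      simpa using this
    have h2 : 0 ≤ c ^ 2 * (U - M) := mul_nonneg (sq_nonneg c) (by linarith)
    have h3 : 0 ≤ 2 * (c * √(1 - c ^ 2)) * s := by positivity
    have h4 : 0 ≤ (1 - c ^ 2) * (s ^ 2 / (U - M)) :=
      mul_nonneg ha.le (div_nonneg (sq_nonneg s) (by linarith))
    linarith

/-! ### The finite-sampling bound -/

theorem corollary1 {Ω 𝒵 : Type*} [MeasurableSpace Ω] [MeasurableSpace 𝒵]
    (μ : Measure Ω) [IsProbabilityMeasure μ] (P : Measure 𝒵) [IsProbabilityMeasure P]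
    (n : ℕ) (hn : 2 ≤ n)
    (Z : Fin n → Ω → 𝒵) (hlaw : ∀ i, HasLaw (Z i) P μ) (hindep : iIndepFun Z μ)
    (M : ℝ) (hM : 0 < M) (ℓ : 𝒵 → ℝ) (hℓ : Measurable ℓ) (hrange : ∀ z, ℓ z ∈ Set.Icc 0 M)
    (ρ : ℝ) (hρ : 0 < ρ) (δ : ℝ) (hδ : δ ∈ Set.Ioo (0 : ℝ) 1) :
    1 - δ ≤ μ.real {ω |
      RadiusSmallEnough n M ρ δ (sampleMean fun i => ℓ (Z i ω))
        (sampleVariance fun i => ℓ (Z i ω)) →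
      worstCaseRisk P ρ ℓ ≤
        finiteSamplingBound n M ρ δ (sampleMean fun i => ℓ (Z i ω))
          (sampleVariance fun i => ℓ (Z i ω))} := by
  obtain ⟨hδ0, hδ1⟩ := hδ
  have hl : 0 < Real.log (2 / δ) := Real.log_pos (by rw [lt_div_iff₀ hδ0]; linarith)
  have hexp : Real.exp (-Real.log (2 / δ)) = δ / 2 := by
    rw [Real.exp_neg, Real.exp_log (by positivity), inv_div]
  set X : Fin n → Ω → ℝ := fun i ω => ℓ (Z i ω)
  have hXm : ∀ i, AEMeasurable (X i) μ := fun i => hℓ.comp_aemeasurable (hlaw i).aemeasurable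
  have hX : iIndepFun X μ := hindep.comp (fun _ => ℓ) fun _ => hℓ
  have hXM : ∀ i ω, X i ω ∈ Set.Icc 0 M := fun i ω => hrange _
  have he : ∀ i, μ[X i] = ∫ z, ℓ z ∂P := fun i =>
    (hlaw i).integral_comp hℓ.aestronglyMeasurable
  have hv : ∀ i, Var[X i; μ] = Var[ℓ; P] := fun i => by
    rw [variance_eq_integral (hXm i), variance_eq_integral hℓ.aemeasurable, he i]
    exact (hlaw i).integral_comp (f := fun z => (ℓ z - ∫ z, ℓ z ∂P) ^ 2)
      ((hℓ.sub_const _).pow_const 2).aestronglyMeasurable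
  have h1 := measureReal_sampleMean_add_lt_le (by omega) hX hXm hM hXM he hl.le
  have h2 := measureReal_sqrt_sampleVariance_add_lt_le hn hX hXm hM hXM he hv hl.le
  rw [hexp] at h1 h2
  set A := {ω | (sampleMean fun i => X i ω) + M * √(Real.log (2 / δ) / (2 * n)) < ∫ z, ℓ z ∂P}
  set B := {ω | √(sampleVariance fun i => X i ω) + M * √(2 * Real.log (2 / δ) / (n - 1))
    < √Var[ℓ; P]}
  set G := {ω | RadiusSmallEnough n M ρ δ (sampleMean fun i => X i ω)
        (sampleVariance fun i => X i ω) →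
      worstCaseRisk P ρ ℓ ≤ finiteSamplingBound n M ρ δ (sampleMean fun i => X i ω)
          (sampleVariance fun i => X i ω)}
  have hcover : Set.univ ⊆ G ∪ (A ∪ B) := by
    intro ω _
    by_contra hω
    simp only [Set.mem_union, not_or] at hω
    obtain ⟨hG, hA, hB⟩ := hω
    exact hG fun hr => worstCaseRisk_le_finiteSamplingBound hn hM hℓ hrange hρ hl
      (sampleVariance_nonneg hn _) (not_lt.mp hA) (not_lt.mp hB) hr
  have h3 := measureReal_mono (μ := μ) hcover
  have h4 := measureReal_union_le (μ := μ) G (A ∪ B)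
  have h5 := measureReal_union_le (μ := μ) A B
  rw [probReal_univ] at h3
  linarith
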